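/- A treeshelf of size $n \ge 0$ is a rooted tree with $n$ nodes, labelled by the distinct integers $1,\dots,n$, such that every node has at most one left child and at most one right child (every child, even an only child, is attached to its parent by either a left or a right link) and the labels increase along every branch starting at the root. The only treeshelf of size $0$ is the empty one. Let $P$ be the treeshelf of size $3$ whose root $1$ has the left child $2$, which in turn has the left child $3$, and no other links. A treeshelf contains $P$ if some of its nodes, together with the links between them, form a copy of $P$ with the same left/right links and with labels in the same relative order (equivalently, if some node has a left child that itself has a left child); otherwise it avoids $P$. Let $pe_n$ (the popularity of left children) be the total number of left children in all treeshelves of size $n$ that avoid $P$. Then: 1. The exponential generating function of $(pe_n)_{n \ge 0}$ is $$\sum_{n\ge 0} pe_n \frac{z^n}{n!} = \frac{1-\sin z+(z-1)\cos z}{(1-\sin z)^2}.$$ 2. For all $n \ge 0$, $pe_n=(n+1)e_n-e_{n+1}$, where $e_n$ is the shifted Euler number, defined by $\sum_{n\ge0} e_n \frac{z^n}{n!}=\frac{1}{1-\sin z}$. 3. As $n\to\infty$, $$\frac{pe_n}{n!} \sim \frac{8(\pi-2)}{\pi^3}\, n^2 \left(\frac{2}{\pi}\right)^n .$$ -/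

import Mathlib

open Filter Asymptotics
open scoped Nat

namespace Treeshelf

/-- The multiset of the labels of a labelled binary tree. -/
def labels : BinaryTree ℕ → Multiset ℕ
  | .nil => 0
  | .node a l r => a ::ₘ (labels l + labels r)

/-- The labels increase along all branches that start at the root: every node carries a smaller
label than each of its descendants. -/
def Increasing : BinaryTree ℕ → Prop
  | .nil => True
  | .node a l r =>
      (∀ b ∈ labels l, a < b) ∧ (∀ b ∈ labels r, a < b) ∧ Increasing l ∧ Increasing r

/-- `IsShelf n T`: the tree `T` is a treeshelf of size `n`, that is, an increasing binary tree in
which every child hangs on a left or a right link, with `n` nodes that are labelled by distinct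
integers in `{1, …, n}`. The empty tree is the treeshelf of size `0`. -/
def IsShelf (n : ℕ) (T : BinaryTree ℕ) : Prop :=
  T.numNodes = n ∧ (labels T).Nodup ∧ (∀ a ∈ labels T, 1 ≤ a ∧ a ≤ n) ∧ Increasing T

/-- A link from a node to a child. -/
inductive Link where
  | left
  | right

/-- The label of the node of `T` that is reached from the root by following the given links,
if there is such a node. -/
def labelAt : BinaryTree ℕ → List Link → Option ℕ
  | .nil, _ => none
  | .node a _ _, [] => some a
  | .node _ l _, .left :: p => labelAt l p
  | .node _ _ r, .right :: p => labelAt r p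

/-- The pattern `P` occurs in `T` at the node with address `v`: placing the root of `P` on that
node, every node of `P` falls on a node of `T` (the left and right links being the same), and the
labels of these nodes of `T` are in the same relative order as those of `P`. -/
def OccursAt (P T : BinaryTree ℕ) (v : List Link) : Prop :=
  (∀ p a, labelAt P p = some a → ∃ b, labelAt T (v ++ p) = some b) ∧
  ∀ p q a a' b b', labelAt P p = some a → labelAt P q = some a' →
    labelAt T (v ++ p) = some b → labelAt T (v ++ q) = some b' → (a < a' ↔ b < b')

/-- `T` avoids `P`: it contains no occurrence of `P`. -/
def Avoids (P T : BinaryTree ℕ) : Prop := ∀ v, ¬ OccursAt P T v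

/-- The number of left children in a tree. -/
def leftChildren : BinaryTree ℕ → ℕ
  | .nil => 0
  | .node _ .nil r => leftChildren r
  | .node _ (.node a l r') r => 1 + leftChildren (.node a l r') + leftChildren r

theorem finite_bounded (n : ℕ) : ∀ k : ℕ,
    {T : BinaryTree ℕ | T.numNodes ≤ k ∧ ∀ a ∈ labels T, a ≤ n}.Finite := by
  intro k
  induction k with
  | zero =>
    refine (Set.finite_singleton BinaryTree.nil).subset ?_
    rintro (_ | ⟨a, l, r⟩) ⟨h, -⟩
    · rfl
    · simp [BinaryTree.numNodes] at h
  | succ k ih =>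
    have hfin := ((Set.finite_Iic n).prod (ih.prod ih)).image
      (fun x : ℕ × BinaryTree ℕ × BinaryTree ℕ => BinaryTree.node x.1 x.2.1 x.2.2)
    refine (hfin.union (Set.finite_singleton BinaryTree.nil)).subset ?_
    rintro (_ | ⟨a, l, r⟩) ⟨h, h'⟩
    · exact Or.inr rfl
    · simp only [BinaryTree.numNodes] at h
      simp only [labels, Multiset.mem_cons, Multiset.mem_add] at h'
      refine Or.inl ⟨(a, l, r), ⟨h' a (Or.inl rfl), ⟨?_, ?_⟩, ⟨?_, ?_⟩⟩, rfl⟩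
      · show l.numNodes ≤ k
        omega
      · exact fun b hb => h' b (Or.inr (Or.inl hb))
      · show r.numNodes ≤ k
        omega
      · exact fun b hb => h' b (Or.inr (Or.inr hb))

/-- There are finitely many treeshelves of size `n` that avoid `P`. -/
theorem finite_avoiders (P : BinaryTree ℕ) (n : ℕ) :
    {T : BinaryTree ℕ | IsShelf n T ∧ Avoids P T}.Finite :=
  (finite_bounded n n).subset fun _ hT => ⟨hT.1.1.le, fun a ha => (hT.1.2.2.1 a ha).2⟩

/-- The treeshelves of size `n` that avoid `P`. -/
noncomputable def avoiders (P : BinaryTree ℕ) (n : ℕ) : Finset (BinaryTree ℕ) :=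
  (finite_avoiders P n).toFinset

/-- The popularity of the left children among the treeshelves that avoid `P`: the total number of
left children in all treeshelves of size `n` that avoid `P`. -/
noncomputable def popularity (P : BinaryTree ℕ) (n : ℕ) : ℕ :=
  ∑ T ∈ avoiders P n, leftChildren T

/-- The treeshelf of size three in which the root `1` has the left child `2`, which has the left
child `3`. -/
def leftPath3 : BinaryTree ℕ :=
  .node 1 (.node 2 (.node 3 .nil .nil) .nil) .nil

/-- The exponential generating function of a sequence, as a formal power series. -/
noncomputable def egf (u : ℕ → ℚ) : PowerSeries ℚ :=
  PowerSeries.mk fun n => u n / (n ! : ℚ)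

/-- The formal power series `1 / (1 - sin z)`. -/
noncomputable def Eul : PowerSeries ℚ := (1 - PowerSeries.sin ℚ)⁻¹

/-- The shifted Euler numbers, whose exponential generating function is `1 / (1 - sin z)`. -/
noncomputable def shiftedEuler (n : ℕ) : ℚ := (n ! : ℚ) * PowerSeries.coeff n Eul

end Treeshelf

/-! Labels increase downwards, so an occurrence of `leftPath3` is just a left child that has a left
child. Deleting the root of an increasing tree leaves two increasing trees on complementary label
sets; for exponential generating functions this reads: derivative = product of the subtree series.
Avoidance forces the root of the left subtree to have no left child, so a second class is needed.
With `A`, `B` counting avoiders and avoiders with leftless root, and `p`, `q` summing left children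
over them, this yields the system of `represents_of_system`. Its solution is `A = 1/(1 - sin)`, `B =
cos/(1 - sin)`, `q = (X - 1)A + 1`, `p = q'` (`egf_popularity`). Since `p` is the derivative of `(X
- 1)A`, comparing coefficients gives part 2.

For the asymptotics, `A = B'`, and `B` has a simple pole at `π/2` with no other singularity in the
disc of radius `4`. So `(π/2 - z)B` has a power series converging at `π/2`, to the value `2`; its
partial sums there are the rescaled coefficients of `B` (`tendsto_coeff_cos_mul_Eul`). Two
applications of `n + 1` times a shifted coefficient turn this limit into the growth `n² (2/π)^n`. -/

namespace Treeshelf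

/-! ### Avoidance as a local condition on the shape -/

/-- The root of the tree, if there is one, has no left child. -/
def RootLeftless : BinaryTree ℕ → Prop
  | .nil => True
  | .node _ l _ => l = .nil

/-- No left child has a left child. -/
def NoLeftLeft : BinaryTree ℕ → Prop
  | .nil => True
  | .node _ l r => RootLeftless l ∧ NoLeftLeft l ∧ NoLeftLeft r

theorem labelAt_leftPath3 (p : List Link) (a : ℕ) :
    labelAt leftPath3 p = some a ↔
      (p = [] ∧ a = 1) ∨ (p = [.left] ∧ a = 2) ∨ (p = [.left, .left] ∧ a = 3) := by
  rcases p with _ | ⟨_ | _, _ | ⟨_ | _, _ | ⟨_ | _, p⟩⟩⟩ <;>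
    simp [leftPath3, labelAt, @eq_comm ℕ _ a]

/-- Along a chain of left links the labels increase by themselves, so the order condition is
automatic and only the existence of the three nodes matters. -/
theorem occursAt_leftPath3_nil_iff {a : ℕ} {l r : BinaryTree ℕ}
    (h : Increasing (.node a l r)) :
    OccursAt leftPath3 (.node a l r) [] ↔ ¬ RootLeftless l := by
  constructor
  · rintro ⟨h1, -⟩ hl
    obtain ⟨b, hb⟩ := h1 [.left, .left] 3 ((labelAt_leftPath3 _ _).2 (by simp))
    rcases l with _ | ⟨c, l, r'⟩
    · simp [labelAt] at hb
    · simp only [RootLeftless] at hl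
      subst hl
      simp [labelAt] at hb
  · intro hl
    rcases l with _ | ⟨c, _ | ⟨d, l, r''⟩, r'⟩
    · exact absurd trivial hl
    · exact absurd rfl hl
    · have hac : a < c := h.1 c (by simp [labels])
      have hcd : c < d := h.2.2.1.1 d (by simp [labels])
      constructor
      · intro p x hp
        rcases (labelAt_leftPath3 p x).1 hp with ⟨rfl, -⟩ | ⟨rfl, -⟩ | ⟨rfl, -⟩ <;>
          simp [labelAt]
      · intro p q x x' b b' hp hq hb hb'
        rcases (labelAt_leftPath3 p x).1 hp with ⟨rfl, rfl⟩ | ⟨rfl, rfl⟩ | ⟨rfl, rfl⟩ <;>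
        rcases (labelAt_leftPath3 q x').1 hq with ⟨rfl, rfl⟩ | ⟨rfl, rfl⟩ | ⟨rfl, rfl⟩ <;>
        simp [labelAt] at hb hb' <;> omega

theorem avoids_leftPath3_iff {T : BinaryTree ℕ} (h : Increasing T) :
    Avoids leftPath3 T ↔ NoLeftLeft T := by
  induction T with
  | nil =>
    refine ⟨fun _ => trivial, fun _ v hv => ?_⟩
    obtain ⟨b, hb⟩ := hv.1 [] 1 rfl
    simp [labelAt] at hb
  | node a l r ihl ihr =>
    rw [NoLeftLeft, ← ihl h.2.2.1, ← ihr h.2.2.2, ← not_not (a := RootLeftless l),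
      ← occursAt_leftPath3_nil_iff h]
    constructor
    · exact fun H => ⟨H [], fun v => H (.left :: v), fun v => H (.right :: v)⟩
    · rintro ⟨h0, h1, h2⟩ (_ | ⟨_ | _, v⟩)
      exacts [h0, h1 v, h2 v]

/-! ### Increasing trees on arbitrary label sets and their root decomposition -/

theorem card_labels (T : BinaryTree ℕ) : (labels T).card = T.numNodes := by
  induction T with
  | nil => rfl
  | node a l r ihl ihr => simp [labels, BinaryTree.numNodes, ihl, ihr]

theorem finite_increasing (S : Finset ℕ) :
    {T : BinaryTree ℕ | labels T = S.val ∧ Increasing T}.Finite := by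
  refine (finite_bounded (S.sup id) S.card).subset ?_
  rintro T ⟨hT, -⟩
  refine ⟨by rw [← card_labels, hT]; rfl, fun a ha => ?_⟩
  rw [hT] at ha
  exact Finset.le_sup (f := id) (show a ∈ S from ha)

/-- The increasing binary trees whose labels are the elements of `S`. -/
noncomputable def incTrees (S : Finset ℕ) : Finset (BinaryTree ℕ) := (finite_increasing S).toFinset

theorem mem_incTrees {S : Finset ℕ} {T : BinaryTree ℕ} :
    T ∈ incTrees S ↔ labels T = S.val ∧ Increasing T := by
  simp [incTrees]

/-- By cardinality, `n` distinct labels in `{1, …, n}` exhaust it. General label sets are needed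
because subtrees do not carry initial segments. -/
theorem isShelf_iff {n : ℕ} {T : BinaryTree ℕ} :
    IsShelf n T ↔ T ∈ incTrees (Finset.Icc 1 n) := by
  rw [mem_incTrees, IsShelf]
  constructor
  · rintro ⟨h1, h2, h3, h4⟩
    refine ⟨?_, h4⟩
    have : (⟨labels T, h2⟩ : Finset ℕ) = Finset.Icc 1 n :=
      Finset.eq_of_subset_of_card_le (fun a ha => Finset.mem_Icc.2 (h3 a ha)) (by
        simp [card_labels, h1])
    exact congrArg Finset.val this
  · rintro ⟨h, h4⟩
    refine ⟨by rw [← card_labels, h]; simp, by rw [h]; exact Finset.nodup _, ?_, h4⟩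
    intro a ha
    rw [h] at ha
    exact Finset.mem_Icc.1 ha

theorem incTrees_empty : incTrees ∅ = {.nil} := by
  ext T
  rw [mem_incTrees, Finset.mem_singleton]
  constructor
  · rintro ⟨h, -⟩
    cases T with
    | nil => rfl
    | node => simp [labels] at h
  · rintro rfl
    exact ⟨rfl, trivial⟩

/-- An increasing tree is its least label together with a splitting of the other labels between
the increasing left and right subtrees. -/
theorem sum_incTrees_insert {M : Type*} [AddCommMonoid M] {a : ℕ} {S : Finset ℕ}
    (ha : ∀ b ∈ S, a < b) (f : BinaryTree ℕ → M) :
    ∑ T ∈ incTrees (insert a S), f T =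
      ∑ U ∈ S.powerset, ∑ l ∈ incTrees U, ∑ r ∈ incTrees (S \ U), f (.node a l r) := by
  have haS : a ∉ S := fun h => lt_irrefl _ (ha a h)
  simp_rw [← Finset.sum_product']
  rw [Finset.sum_sigma']
  symm
  refine Finset.sum_bij (fun x _ => BinaryTree.node a x.2.1 x.2.2) ?_ ?_ ?_ (fun _ _ => rfl)
  · rintro ⟨U, l, r⟩ hx
    simp only [Finset.mem_sigma, Finset.mem_powerset, Finset.mem_product, mem_incTrees] at hx
    obtain ⟨hU, ⟨hl, hl'⟩, hr, hr'⟩ := hx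
    rw [mem_incTrees]
    refine ⟨?_, ?_, ?_, hl', hr'⟩
    · rw [labels, hl, hr, Finset.insert_val_of_notMem haS, Finset.sdiff_val,
        add_tsub_cancel_of_le (Finset.val_le_iff.2 hU)]
    · intro b hb
      rw [hl] at hb
      exact ha b (hU hb)
    · intro b hb
      rw [hr] at hb
      exact ha b (Finset.sdiff_subset hb)
  · rintro ⟨U, l, r⟩ hx ⟨U', l', r'⟩ hx' h
    simp only [Finset.mem_sigma, Finset.mem_powerset, Finset.mem_product, mem_incTrees] at hx hx'
    simp only [BinaryTree.node.injEq, true_and] at h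
    obtain ⟨rfl, rfl⟩ := h
    obtain rfl : U = U' := Finset.val_injective (hx.2.1.1.symm.trans hx'.2.1.1)
    rfl
  · intro T hT
    rw [mem_incTrees, Finset.insert_val_of_notMem haS] at hT
    obtain ⟨hT, hT'⟩ := hT
    cases T with
    | nil => simp [labels] at hT
    | node c l r =>
      -- Both `a` and `c` are the least label: `a` by `ha`, `c` because the tree is increasing.
      have hac : a = c := by
        have h1 : a ∈ c ::ₘ (labels l + labels r) := by
          rw [show c ::ₘ (labels l + labels r) = _ from hT]; exact Multiset.mem_cons_self _ _
        have h2 : c ∈ a ::ₘ S.val := by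
          rw [← hT]; exact Multiset.mem_cons_self _ _
        rcases Multiset.mem_cons.1 h2 with h | h
        · exact h.symm
        · rcases Multiset.mem_cons.1 h1 with h1 | h1
          · exact h1
          · have hca : c < a := by
              rcases Multiset.mem_add.1 h1 with h1 | h1
              exacts [hT'.1 a h1, hT'.2.1 a h1]
            exact absurd hca (ha c h).not_gt
      subst hac
      have hS : labels l + labels r = S.val := (Multiset.cons_inj_right a).1 hT
      have hnd : (labels l).Nodup :=
        Multiset.nodup_of_le (hS ▸ Multiset.le_add_right _ _) S.nodup
      have hle : (⟨labels l, hnd⟩ : Finset ℕ) ⊆ S :=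
        Finset.val_le_iff.1 (hS ▸ Multiset.le_add_right _ _)
      refine ⟨⟨⟨labels l, hnd⟩, l, r⟩, ?_, rfl⟩
      simp only [Finset.mem_sigma, Finset.mem_powerset, Finset.mem_product, mem_incTrees]
      refine ⟨hle, ⟨trivial, hT'.2.2.1⟩, ?_, hT'.2.2.2⟩
      rw [Finset.sdiff_val, ← hS]
      simp

/-! ### Translation into exponential generating functions -/

/-- `F` is the exponential generating function of the sums of `f` over the increasing trees,
up to size `n`. -/
def Represents (n : ℕ) (f : BinaryTree ℕ → ℚ) (F : PowerSeries ℚ) : Prop :=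
  ∀ S : Finset ℕ, S.card ≤ n → ∑ T ∈ incTrees S, f T = (S.card ! : ℚ) * PowerSeries.coeff S.card F

theorem Represents.sub {n : ℕ} {f g : BinaryTree ℕ → ℚ} {F G : PowerSeries ℚ}
    (hf : Represents n f F) (hg : Represents n g G) :
    Represents n (fun T => f T - g T) (F - G) := fun S hS => by
  rw [Finset.sum_sub_distrib, hf S hS, hg S hS, map_sub, mul_sub]

/-- The inner sums depend on `U` only through its size `k`, and the number of such `U` is the
binomial coefficient that turns products of factorials into `S.card !`. -/
theorem Represents.sum_mul {n : ℕ} {f g : BinaryTree ℕ → ℚ} {F G : PowerSeries ℚ}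
    (hf : Represents n f F) (hg : Represents n g G) {S : Finset ℕ} (hS : S.card ≤ n) :
    ∑ U ∈ S.powerset, ∑ l ∈ incTrees U, ∑ r ∈ incTrees (S \ U), f l * g r =
      (S.card ! : ℚ) * PowerSeries.coeff S.card (F * G) := by
  have h : ∀ U ∈ S.powerset, ∑ l ∈ incTrees U, ∑ r ∈ incTrees (S \ U), f l * g r =
      (fun k => ((k ! : ℚ) * PowerSeries.coeff k F) *
        (((S.card - k)! : ℚ) * PowerSeries.coeff (S.card - k) G)) U.card := by
    intro U hU
    rw [Finset.mem_powerset] at hU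
    have h1 := Finset.card_le_card hU
    have h2 := Finset.card_sdiff_of_subset hU
    rw [← Finset.sum_mul_sum, hf U (h1.trans hS), hg (S \ U) (by omega), h2]
  rw [Finset.sum_congr rfl h, Finset.sum_powerset_apply_card (fun k =>
    ((k ! : ℚ) * PowerSeries.coeff k F) *
      (((S.card - k)! : ℚ) * PowerSeries.coeff (S.card - k) G)), PowerSeries.coeff_mul,
    Finset.Nat.sum_antidiagonal_eq_sum_range_succ
      (fun i j => PowerSeries.coeff i F * PowerSeries.coeff j G), Finset.mul_sum]
  refine Finset.sum_congr rfl fun k hk => ?_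
  have hk' : k ≤ S.card := Nat.lt_succ_iff.1 (Finset.mem_range.1 hk)
  rw [nsmul_eq_mul, ← Nat.choose_mul_factorial_mul_factorial hk']
  push_cast
  ring

/-- The root must carry the minimum of `S`; removing it lowers the size by one, which is
differentiation of the series. -/
theorem Represents.succ {n : ℕ} {f : BinaryTree ℕ → ℚ} {F G : PowerSeries ℚ}
    (h : Represents n f F) (hG : PowerSeries.derivative ℚ F = G)
    (hf : ∀ (a : ℕ) (S : Finset ℕ), S.card = n →
      ∑ U ∈ S.powerset, ∑ l ∈ incTrees U, ∑ r ∈ incTrees (S \ U), f (.node a l r) =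
        (n ! : ℚ) * PowerSeries.coeff n G) :
    Represents (n + 1) f F := by
  intro S hS
  rcases Nat.le_succ_iff.1 hS with hS | hS
  · exact h S hS
  · have hne : S.Nonempty := by
      rw [← Finset.card_pos]; omega
    have hmin := S.min'_mem hne
    have hcard : (S.erase (S.min' hne)).card = n := by
      rw [Finset.card_erase_of_mem hmin]; omega
    have hlt : ∀ b ∈ S.erase (S.min' hne), S.min' hne < b := fun b hb =>
      S.min'_lt_of_mem_erase_min' hne hb
    rw [hS]
    conv_lhs => rw [← Finset.insert_erase hmin]
    rw [sum_incTrees_insert hlt, hf _ _ hcard, ← hG, PowerSeries.coeff_derivative,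
      Nat.factorial_succ]
    push_cast
    ring

theorem represents_zero {f : BinaryTree ℕ → ℚ} {F : PowerSeries ℚ}
    (h : f .nil = PowerSeries.constantCoeff F) : Represents 0 f F := by
  intro S hS
  obtain rfl : S = ∅ := by simpa using hS
  simp [incTrees_empty, h]

/-! ### Root recursions for the avoiders and their left children -/

open Classical in
/-- The indicator function of the empty tree. -/
noncomputable def nilInd (T : BinaryTree ℕ) : ℚ := if T = .nil then 1 else 0

open Classical in
/-- The indicator function of the trees in which no left child has a left child. -/
noncomputable def avoidInd (T : BinaryTree ℕ) : ℚ := if NoLeftLeft T then 1 else 0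

open Classical in
/-- The restriction of `avoidInd` to the trees whose root has no left child. -/
noncomputable def leftlessInd (T : BinaryTree ℕ) : ℚ := if RootLeftless T then avoidInd T else 0

theorem avoidInd_node (a : ℕ) (l r : BinaryTree ℕ) :
    avoidInd (.node a l r) = leftlessInd l * avoidInd r := by
  by_cases h1 : RootLeftless l <;> by_cases h2 : NoLeftLeft l <;> by_cases h3 : NoLeftLeft r <;>
    simp [avoidInd, leftlessInd, NoLeftLeft, h1, h2, h3]

theorem leftlessInd_node (a : ℕ) (l r : BinaryTree ℕ) :
    leftlessInd (.node a l r) = nilInd l * avoidInd r := by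
  by_cases h : l = .nil
  · subst h
    have h : leftlessInd .nil = 1 := by simp [leftlessInd, avoidInd, NoLeftLeft, RootLeftless]
    rw [leftlessInd, if_pos (show RootLeftless (.node a .nil r) from rfl), avoidInd_node, h]
    simp [nilInd]
  · simp [leftlessInd, nilInd, RootLeftless, h]

theorem leftChildren_node (a : ℕ) (l r : BinaryTree ℕ) :
    (leftChildren (.node a l r) : ℚ) = leftChildren l + leftChildren r + (1 - nilInd l) := by
  cases l <;> simp [leftChildren, nilInd]
  ring

/-- The three terms count left children inside `l`, inside `r`, and the root of `l` itself, which is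
present exactly when `l` is nonempty. -/
theorem avoidInd_mul_leftChildren_node (a : ℕ) (l r : BinaryTree ℕ) :
    avoidInd (.node a l r) * leftChildren (.node a l r) =
      leftlessInd l * leftChildren l * avoidInd r + leftlessInd l * (avoidInd r * leftChildren r) +
        (leftlessInd l - nilInd l) * avoidInd r := by
  have h : leftlessInd l * nilInd l = nilInd l := by
    cases l <;> simp [leftlessInd, nilInd, avoidInd, RootLeftless, NoLeftLeft]
  rw [avoidInd_node, leftChildren_node]
  linear_combination -avoidInd r * h

theorem leftlessInd_mul_leftChildren_node (a : ℕ) (l r : BinaryTree ℕ) :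
    leftlessInd (.node a l r) * leftChildren (.node a l r) =
      nilInd l * (avoidInd r * leftChildren r) := by
  rw [leftlessInd_node, leftChildren_node]
  cases l <;> simp [nilInd, leftChildren]

theorem represents_nilInd (n : ℕ) : Represents n nilInd 1 := by
  induction n with
  | zero => exact represents_zero (by simp [nilInd])
  | succ n ih =>
    refine ih.succ (G := 0) (by simp) fun a S _ => ?_
    simp [nilInd]

/-- The system of differential equations that determines the generating functions of the avoiding
trees (`A`, `B`) and of the numbers of their left children (`p`, `q`); in `B` and `q` the root has
no left child. -/
theorem represents_of_system {A B p q : PowerSeries ℚ}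
    (hA0 : PowerSeries.constantCoeff A = 1) (hB0 : PowerSeries.constantCoeff B = 1)
    (hp0 : PowerSeries.constantCoeff p = 0) (hq0 : PowerSeries.constantCoeff q = 0)
    (hA : PowerSeries.derivative ℚ A = B * A) (hB : PowerSeries.derivative ℚ B = 1 * A)
    (hp : PowerSeries.derivative ℚ p = q * A + B * p + (B - 1) * A)
    (hq : PowerSeries.derivative ℚ q = 1 * p) (n : ℕ) :
    Represents n avoidInd A ∧ Represents n leftlessInd B ∧
      Represents n (fun T => avoidInd T * leftChildren T) p ∧
      Represents n (fun T => leftlessInd T * leftChildren T) q := by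
  -- The four series are mutually dependent, but their sums at size `n + 1` involve only sizes up to
  -- `n`; hence one joint induction.
  induction n with
  | zero =>
    refine ⟨represents_zero ?_, represents_zero ?_, represents_zero ?_, represents_zero ?_⟩ <;>
      simp [*, avoidInd, leftlessInd, NoLeftLeft, RootLeftless, leftChildren]
  | succ n ih =>
    obtain ⟨iA, iB, ip, iq⟩ := ih
    have i1 := represents_nilInd n
    refine ⟨iA.succ hA fun a S hS => ?_, iB.succ hB fun a S hS => ?_, ip.succ hp fun a S hS => ?_,
      iq.succ hq fun a S hS => ?_⟩ <;> subst hS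
    · simp only [avoidInd_node]
      exact iB.sum_mul iA le_rfl
    · simp only [leftlessInd_node]
      exact i1.sum_mul iA le_rfl
    · simp only [avoidInd_mul_leftChildren_node, Finset.sum_add_distrib]
      rw [map_add, map_add, mul_add, mul_add, ← iq.sum_mul iA le_rfl, ← iB.sum_mul ip le_rfl,
        ← (iB.sub i1).sum_mul iA le_rfl]
    · simp only [leftlessInd_mul_leftChildren_node]
      exact i1.sum_mul ip le_rfl

theorem popularity_eq_sum (n : ℕ) :
    (popularity leftPath3 n : ℚ) =
      ∑ T ∈ incTrees (Finset.Icc 1 n), avoidInd T * leftChildren T := by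
  classical
  have h : avoiders leftPath3 n = (incTrees (Finset.Icc 1 n)).filter NoLeftLeft := by
    ext T
    rw [avoiders, Set.Finite.mem_toFinset, Finset.mem_filter, Set.mem_ofPred_eq, isShelf_iff]
    exact and_congr_right fun hT => avoids_leftPath3_iff (mem_incTrees.1 hT).2
  rw [popularity, h, Finset.sum_filter, Nat.cast_sum]
  refine Finset.sum_congr rfl fun T _ => ?_
  by_cases hT : NoLeftLeft T <;> simp [avoidInd, hT]

/-! ### Formal trigonometry and the solution of the system -/

open PowerSeries in
theorem derivative_sin : derivative ℚ (sin ℚ) = cos ℚ := by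
  ext n
  rw [coeff_derivative, sin, cos, coeff_mk, coeff_mk]
  by_cases h : Even n
  · obtain ⟨k, rfl⟩ := h
    have h1 : (k + k + 1) / 2 = k := by omega
    have h2 : (k + k) / 2 = k := by omega
    have h3 : ¬ Even (k + k + 1) := by simp [Nat.even_add_one]
    have h4 : Even (k + k) := ⟨k, rfl⟩
    rw [if_neg h3, if_pos h4, h1, h2, Nat.factorial_succ]
    simp only [eq_ratCast, Rat.cast_id]
    push_cast
    field_simp
  · rw [if_pos (Nat.even_add_one.2 h), if_neg h, zero_mul]

open PowerSeries in
theorem derivative_cos : derivative ℚ (cos ℚ) = -sin ℚ := by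
  ext n
  rw [coeff_derivative, map_neg, sin, cos, coeff_mk, coeff_mk]
  by_cases h : Even n
  · rw [if_neg (by simpa [Nat.even_add_one] using h), if_pos h, zero_mul, neg_zero]
  · obtain ⟨k, rfl⟩ := Nat.not_even_iff_odd.1 h
    have h1 : (2 * k + 1 + 1) / 2 = k + 1 := by omega
    have h2 : (2 * k + 1) / 2 = k := by omega
    rw [if_pos (Nat.even_add_one.2 h), if_neg h, h1, h2, Nat.factorial_succ (2 * k + 1)]
    simp only [eq_ratCast, Rat.cast_id]
    push_cast
    field_simp
    ring

theorem constantCoeff_sin : PowerSeries.constantCoeff (PowerSeries.sin ℚ) = 0 := by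
  rw [← PowerSeries.coeff_zero_eq_constantCoeff_apply, PowerSeries.sin, PowerSeries.coeff_mk]
  simp

theorem constantCoeff_cos : PowerSeries.constantCoeff (PowerSeries.cos ℚ) = 1 := by
  rw [← PowerSeries.coeff_zero_eq_constantCoeff_apply, PowerSeries.cos, PowerSeries.coeff_mk]
  simp

open PowerSeries in
theorem sin_sq_add_cos_sq : sin ℚ ^ 2 + cos ℚ ^ 2 = 1 := by
  refine derivative.ext (R := ℚ) ?_ ?_
  · rw [map_add, derivative_pow, derivative_pow, derivative_sin, derivative_cos, derivative_one]
    ring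
  · simp [constantCoeff_sin, constantCoeff_cos]

theorem constantCoeff_one_sub_sin :
    PowerSeries.constantCoeff (1 - PowerSeries.sin ℚ) = 1 := by
  simp [constantCoeff_sin]

theorem Eul_mul : Eul * (1 - PowerSeries.sin ℚ) = 1 :=
  PowerSeries.inv_mul_cancel _ (by simp [constantCoeff_one_sub_sin])

theorem constantCoeff_Eul : PowerSeries.constantCoeff Eul = 1 := by
  rw [Eul, PowerSeries.constantCoeff_inv, constantCoeff_one_sub_sin, inv_one]

theorem derivative_Eul :
    PowerSeries.derivative ℚ Eul = PowerSeries.cos ℚ * Eul * Eul := by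
  rw [Eul, PowerSeries.derivative_inv', map_sub, derivative_sin, PowerSeries.derivative_one]
  ring

theorem derivative_cos_mul_Eul :
    PowerSeries.derivative ℚ (PowerSeries.cos ℚ * Eul) = Eul := by
  rw [Derivation.leibniz, derivative_Eul, derivative_cos, smul_eq_mul, smul_eq_mul]
  linear_combination Eul ^ 2 * sin_sq_add_cos_sq + (PowerSeries.sin ℚ * Eul + Eul) * Eul_mul

open PowerSeries in
theorem egf_popularity :
    egf (fun n => (popularity leftPath3 n : ℚ)) = Eul + (X - 1) * (cos ℚ * Eul * Eul) := by
  have hX : derivative ℚ (X - 1 : PowerSeries ℚ) = 1 := by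
    rw [map_sub, derivative_X, derivative_one, sub_zero]
  -- With `A' = BA` and `B' = A`, the equations for `p`, `q` integrate to `q' = Bq + A - B`. Putting
  -- `q = Ay` gives `y' = 1 - cos`, so `q = (X - sin)A = (X - 1)A + 1`.
  have hp : derivative ℚ (Eul + (X - 1) * (cos ℚ * Eul * Eul)) =
      ((X - 1) * Eul + 1) * Eul + cos ℚ * Eul * (Eul + (X - 1) * (cos ℚ * Eul * Eul)) +
        (cos ℚ * Eul - 1) * Eul := by
    rw [map_add, Derivation.leibniz, Derivation.leibniz _ (cos ℚ * Eul), hX,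
      derivative_cos_mul_Eul, derivative_Eul]
    simp only [smul_eq_mul]
    ring
  have hq : derivative ℚ ((X - 1) * Eul + 1) =
      1 * (Eul + (X - 1) * (cos ℚ * Eul * Eul)) := by
    rw [map_add, Derivation.leibniz, hX, derivative_Eul, derivative_one]
    simp only [smul_eq_mul]
    ring
  ext n
  have h := (represents_of_system (A := Eul) (B := cos ℚ * Eul) constantCoeff_Eul
    (by simp [constantCoeff_Eul, constantCoeff_cos])
    (by simp [constantCoeff_Eul, constantCoeff_cos]) (by simp [constantCoeff_Eul])
    derivative_Eul (by rw [derivative_cos_mul_Eul, one_mul]) hp hq n).2.2.1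
    (Finset.Icc 1 n) (by simp)
  rw [egf, coeff_mk, popularity_eq_sum, h, Nat.card_Icc, Nat.add_sub_cancel,
    mul_div_cancel_left₀ _ (by positivity)]

open PowerSeries in
theorem egf_popularity_eq :
    egf (fun n => (popularity leftPath3 n : ℚ)) =
      (1 - sin ℚ + (X - 1) * cos ℚ) * ((1 - sin ℚ) ^ 2)⁻¹ := by
  rw [eq_mul_inv_iff_mul_eq (by simp [constantCoeff_sin]), egf_popularity]
  linear_combination (1 - sin ℚ + (X - 1) * cos ℚ * (Eul * (1 - sin ℚ) + 1)) * Eul_mul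

theorem popularity_eq (n : ℕ) :
    (popularity leftPath3 n : ℚ) = ((n : ℚ) + 1) * shiftedEuler n - shiftedEuler (n + 1) := by
  have h : egf (fun n => (popularity leftPath3 n : ℚ)) =
      PowerSeries.derivative ℚ ((PowerSeries.X - 1) * Eul) := by
    rw [egf_popularity, Derivation.leibniz, map_sub, PowerSeries.derivative_X,
      PowerSeries.derivative_one, derivative_Eul]
    simp only [smul_eq_mul]
    ring
  have h' := congrArg (PowerSeries.coeff n) h
  rw [egf, PowerSeries.coeff_mk, PowerSeries.coeff_derivative, sub_mul, one_mul, map_sub,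
    PowerSeries.coeff_succ_X_mul, div_eq_iff (by positivity)] at h'
  rw [h', shiftedEuler, shiftedEuler, Nat.factorial_succ]
  push_cast
  ring

/-- This trades the double pole of `1/(1 - sin)` at `π/2` for the simple pole of `cos/(1 - sin)`. -/
theorem shiftedEuler_eq (n : ℕ) :
    shiftedEuler n =
      (n ! : ℚ) * ((n + 1) * PowerSeries.coeff (n + 1) (PowerSeries.cos ℚ * Eul)) := by
  rw [shiftedEuler, ← derivative_cos_mul_Eul, PowerSeries.coeff_derivative,
    derivative_cos_mul_Eul]
  ring

/-! ### The pole at `π/2` -/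

theorem hasSum_sin (z : ℂ) :
    HasSum (fun n => PowerSeries.coeff n (PowerSeries.sin ℂ) * z ^ n) (Complex.sin z) := by
  have hinj : Function.Injective fun n : ℕ => 2 * n + 1 := fun a b h => by simpa using h
  rw [← hinj.hasSum_iff]
  · convert! Complex.hasSum_sin z using 2 with n
    have h1 : (2 * n + 1) / 2 = n := by omega
    have h2 : ¬ Even (2 * n + 1) := by simp
    simp only [Function.comp, PowerSeries.sin, PowerSeries.coeff_mk, if_neg h2, h1]
    simp
    ring
  · intro n hn
    have : Even n := by
      by_contra h
      obtain ⟨k, rfl⟩ := Nat.not_even_iff_odd.1 h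
      exact hn ⟨k, rfl⟩
    simp [PowerSeries.sin, this]

theorem hasSum_cos (z : ℂ) :
    HasSum (fun n => PowerSeries.coeff n (PowerSeries.cos ℂ) * z ^ n) (Complex.cos z) := by
  have hinj : Function.Injective fun n : ℕ => 2 * n := fun a b h => by simpa using h
  rw [← hinj.hasSum_iff]
  · convert! Complex.hasSum_cos z using 2 with n
    have h1 : 2 * n / 2 = n := by omega
    have h2 : Even (2 * n) := by simp
    simp only [Function.comp, PowerSeries.cos, PowerSeries.coeff_mk, if_pos h2, h1]
    simp
    ring
  · intro n hn
    have : ¬ Even n := by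
      rintro ⟨k, rfl⟩
      exact hn ⟨k, two_mul k⟩
    simp [PowerSeries.cos, this]

theorem hasSum_coeff_one (z : ℂ) :
    HasSum (fun n => PowerSeries.coeff n (1 : PowerSeries ℂ) * z ^ n) 1 := by
  convert! hasSum_ite_eq (0 : ℕ) (1 : ℂ) using 2 with n
  rw [PowerSeries.coeff_one]
  split_ifs with h <;> simp [h]

theorem hasSum_coeff_C_sub_X (a z : ℂ) :
    HasSum (fun n => PowerSeries.coeff n (PowerSeries.C a - PowerSeries.X) * z ^ n) (a - z) := by
  have hC := hasSum_ite_eq (0 : ℕ) a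
  have hX := hasSum_ite_eq (1 : ℕ) z
  convert! hC.sub hX using 2 with n
  rw [map_sub, PowerSeries.coeff_C, PowerSeries.coeff_X]
  split_ifs <;> simp_all

theorem hasSum_coeff_mul {F G : PowerSeries ℂ} {z a b : ℂ}
    (hF : HasSum (fun n => PowerSeries.coeff n F * z ^ n) a)
    (hG : HasSum (fun n => PowerSeries.coeff n G * z ^ n) b) :
    HasSum (fun n => PowerSeries.coeff n (F * G) * z ^ n) (a * b) := by
  have h := (summable_norm_sum_mul_antidiagonal_of_summable_norm hF.summable.norm
    hG.summable.norm).of_norm.hasSum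
  rw [← tsum_mul_tsum_eq_tsum_sum_antidiagonal_of_summable_norm hF.summable.norm
    hG.summable.norm, hF.tsum_eq, hG.tsum_eq] at h
  convert! h using 2 with n
  rw [PowerSeries.coeff_mul, Finset.sum_mul]
  refine Finset.sum_congr rfl fun p hp => ?_
  rw [← Finset.HasAntidiagonal.mem_antidiagonal.1 hp, pow_add]
  ring

/-- A formal power series is determined by its sums near `0`. -/
theorem powerSeries_ext_of_hasSum {F G : PowerSeries ℂ} {f : ℂ → ℂ} {r : ℝ} (hr : 0 < r)
    (hF : ∀ z : ℂ, ‖z‖ < r → HasSum (fun n => PowerSeries.coeff n F * z ^ n) (f z))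
    (hG : ∀ z : ℂ, ‖z‖ < r → HasSum (fun n => PowerSeries.coeff n G * z ^ n) (f z)) :
    F = G := by
  have key : ∀ H : PowerSeries ℂ,
      (∀ z : ℂ, ‖z‖ < r → HasSum (fun n => PowerSeries.coeff n H * z ^ n) (f z)) →
      HasFPowerSeriesAt f
        (FormalMultilinearSeries.ofScalars ℂ fun n => PowerSeries.coeff n H) 0 := by
    intro H hH
    rw [hasFPowerSeriesAt_iff]
    filter_upwards [Metric.ball_mem_nhds (0 : ℂ) hr] with z hz
    rw [zero_add]
    convert! hH z (by simpa using hz) using 2 with n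
    rw [FormalMultilinearSeries.coeff_ofScalars, smul_eq_mul, mul_comm]
  have h := (key F hF).eq_formalMultilinearSeries (key G hG)
  ext n
  have h' := congrArg (fun p => FormalMultilinearSeries.coeff p n) h
  simpa [FormalMultilinearSeries.coeff_ofScalars] using h'

theorem sin_ne_zero_of_norm_lt_pi {u : ℂ} (hu : ‖u‖ < Real.pi) (h0 : u ≠ 0) :
    Complex.sin u ≠ 0 := by
  intro h
  obtain ⟨k, rfl⟩ := Complex.sin_eq_zero_iff.1 h
  have hk : k ≠ 0 := by
    rintro rfl
    simp at h0
  rw [norm_mul, Complex.norm_intCast, Complex.norm_real, Real.norm_eq_abs,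
    abs_of_pos Real.pi_pos] at hu
  have h1 : (1 : ℝ) ≤ |(k : ℝ)| := by exact_mod_cast Int.one_le_abs hk
  nlinarith [Real.pi_pos]

/-- `dslope Complex.sin 0 u` is `sin u / u` with the singularity at `0` removed; its zeros are the
nonzero multiples of `π`. -/
theorem dslope_sin_ne_zero {u : ℂ} (hu : ‖u‖ < Real.pi) : dslope Complex.sin 0 u ≠ 0 := by
  rcases eq_or_ne u 0 with rfl | h0
  · simp [dslope_same]
  · intro h
    have h1 := sub_smul_dslope Complex.sin 0 u
    rw [h, smul_zero, Complex.sin_zero, sub_zero] at h1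
    exact sin_ne_zero_of_norm_lt_pi hu h0 h1.symm

/-- The function `(π / 2 - z) cos z / (1 - sin z)` extends holomorphically to a disc that contains
`π / 2`, where its value is `2`. -/
theorem exists_powerSeries_regular :
    ∃ H : PowerSeries ℂ,
      (1 - PowerSeries.sin ℂ) * H =
        (PowerSeries.C ((Real.pi : ℂ) / 2) - PowerSeries.X) * PowerSeries.cos ℂ ∧
      HasSum (fun n => PowerSeries.coeff n H * ((Real.pi : ℂ) / 2) ^ n) 2 := by
  -- Half-angle substitution: `cos z / (1 - sin z) = cot u`, so the function to extend is `2u cot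
  -- u`, that is, `2 cos u / (sin u / u)`.
  set u : ℂ → ℂ := fun z => ((Real.pi : ℂ) / 2 - z) / 2 with hu
  set h : ℂ → ℂ := fun z => 2 * Complex.cos (u z) / dslope Complex.sin 0 (u z) with hh
  have hpi := Real.pi_gt_three
  have hpi4 := Real.pi_le_four
  -- The radius `4` lies beyond `π/2` but before the next pole `-3π/2`.
  have hbound : ∀ z : ℂ, ‖z‖ ≤ 4 → ‖u z‖ < Real.pi := by
    intro z hz
    have h1 : ‖(Real.pi : ℂ) / 2 - z‖ ≤ Real.pi / 2 + 4 := by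
      refine (norm_sub_le _ _).trans (add_le_add (le_of_eq ?_) hz)
      rw [norm_div, Complex.norm_real, Real.norm_eq_abs, abs_of_pos Real.pi_pos]
      simp
    have h2 : ‖u z‖ = ‖(Real.pi : ℂ) / 2 - z‖ / 2 := by simp [hu]
    rw [h2]
    linarith
  have hds : Differentiable ℂ (dslope Complex.sin 0) :=
    differentiableOn_univ.1 ((Complex.differentiableOn_dslope univ_mem).2
      Complex.differentiable_sin.differentiableOn)
  have hud : Differentiable ℂ u := by
    rw [hu]
    fun_prop
  have hdiff : DifferentiableOn ℂ h (Metric.closedBall 0 (4 : NNReal)) := by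
    intro z hz
    have hz' : ‖z‖ ≤ 4 := by simpa using hz
    exact (((Complex.differentiable_cos.comp hud).const_mul 2 z).div ((hds.comp hud) z)
      (dslope_sin_ne_zero (hbound z hz'))).differentiableWithinAt
  have hps := hdiff.hasFPowerSeriesOnBall (by norm_num)
  set H : PowerSeries ℂ := PowerSeries.mk fun n => (cauchyPowerSeries h 0 (4 : NNReal)).coeff n
    with hH
  have hsum : ∀ z : ℂ, ‖z‖ < 4 → HasSum (fun n => PowerSeries.coeff n H * z ^ n) (h z) := by
    intro z hz
    have h1 := hps.hasSum_sub (y := z) (by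
      rw [Metric.mem_eball, edist_zero_right, ← ofReal_norm, ENNReal.ofReal_lt_coe_iff]
      · simpa using hz
      · positivity)
    convert! h1 using 2 with n
    rw [hH, PowerSeries.coeff_mk, FormalMultilinearSeries.apply_eq_pow_smul_coeff, sub_zero,
      smul_eq_mul, mul_comm]
  refine ⟨H, ?_, ?_⟩
  · refine powerSeries_ext_of_hasSum (f := fun z => (1 - Complex.sin z) * h z) (r := 4)
      (by norm_num) ?_ ?_
    · intro z hz
      refine hasSum_coeff_mul ?_ (hsum z hz)
      convert! (hasSum_coeff_one z).sub (hasSum_sin z) using 2 with n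
      rw [map_sub, sub_mul]
    · intro z hz
      convert! hasSum_coeff_mul (hasSum_coeff_C_sub_X ((Real.pi : ℂ) / 2) z) (hasSum_cos z) using 1
      have hD := dslope_sin_ne_zero (hbound z hz.le)
      have hz2 : z = (Real.pi : ℂ) / 2 - 2 * u z := by
        simp only [hu]
        ring
      have hs : Complex.sin z = 1 - 2 * Complex.sin (u z) ^ 2 := by
        rw [hz2, Complex.sin_pi_div_two_sub, ← hz2, Complex.cos_two_mul, Complex.cos_sq']
        ring
      have hc : Complex.cos z = 2 * Complex.sin (u z) * Complex.cos (u z) := by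
        rw [hz2, Complex.cos_pi_div_two_sub, ← hz2, Complex.sin_two_mul]
      have hsl : Complex.sin (u z) = u z * dslope Complex.sin 0 (u z) := by
        have := sub_smul_dslope Complex.sin 0 (u z)
        rwa [Complex.sin_zero, sub_zero, sub_zero, smul_eq_mul, eq_comm] at this
      have hpz : (Real.pi : ℂ) / 2 - z = 2 * u z := by
        simp only [hu]
        ring
      rw [hpz, hc, hs, hh, mul_div_assoc', div_eq_iff hD]
      linear_combination 4 * Complex.sin (u z) * Complex.cos (u z) * hsl
  · have h2 : h ((Real.pi : ℂ) / 2) = 2 := by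
      simp [hh, hu, dslope_same]
    have h3 := hsum ((Real.pi : ℂ) / 2) ?_
    · rwa [h2] at h3
    rw [norm_div, Complex.norm_real, Real.norm_eq_abs, abs_of_pos Real.pi_pos]
    norm_num
    linarith

/-- The coefficients of `cos / (1 - sin)` grow as those of `2 / (π / 2 - z)`. -/
theorem tendsto_coeff_cos_mul_Eul :
    Tendsto (fun n => ((PowerSeries.coeff n (PowerSeries.cos ℚ * Eul) : ℚ) : ℝ) *
      (Real.pi / 2) ^ (n + 1)) atTop (nhds 2) := by
  obtain ⟨H, hH, hsum⟩ := exists_powerSeries_regular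
  set f := algebraMap ℚ ℂ
  set B : PowerSeries ℂ := PowerSeries.map f (PowerSeries.cos ℚ * Eul) with hB
  have hmap : (1 - PowerSeries.sin ℂ) * B = PowerSeries.cos ℂ := by
    rw [← PowerSeries.map_sin f, ← PowerSeries.map_cos f, hB, ← map_one (PowerSeries.map f),
      ← map_sub, ← map_mul]
    congr 1
    linear_combination PowerSeries.cos ℚ * Eul_mul
  have hne : (1 - PowerSeries.sin ℂ) ≠ 0 := by
    intro h
    rw [← PowerSeries.map_sin f, ← map_one (PowerSeries.map f), ← map_sub] at h
    have h' := congrArg PowerSeries.constantCoeff h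
    rw [← PowerSeries.coeff_zero_eq_constantCoeff_apply, PowerSeries.coeff_map,
      PowerSeries.coeff_zero_eq_constantCoeff_apply, constantCoeff_one_sub_sin] at h'
    simp at h'
  have hHB : H = (PowerSeries.C ((Real.pi : ℂ) / 2) - PowerSeries.X) * B := by
    refine mul_left_cancel₀ hne ?_
    rw [hH]
    linear_combination -(PowerSeries.C ((Real.pi : ℂ) / 2) - PowerSeries.X) * hmap
  -- Multiplying by `π/2 - X` makes the terms at `π/2` telescope, leaving a single coefficient of
  -- `B`.
  have hpartial : ∀ n, ∑ k ∈ Finset.range (n + 1),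
      PowerSeries.coeff k H * ((Real.pi : ℂ) / 2) ^ k =
        PowerSeries.coeff n B * ((Real.pi : ℂ) / 2) ^ (n + 1) := by
    intro n
    induction n with
    | zero =>
      simp [hHB, sub_mul, PowerSeries.coeff_zero_eq_constantCoeff_apply]
      ring
    | succ n ih =>
      rw [Finset.sum_range_succ, ih, hHB, sub_mul, map_sub, PowerSeries.coeff_C_mul,
        PowerSeries.coeff_succ_X_mul]
      ring
  have hlim := (hsum.tendsto_sum_nat.comp (tendsto_add_atTop_nat 1))
  rw [← tendsto_ofReal_iff]
  convert! hlim using 2 with n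
  · simp only [Function.comp]
    rw [hpartial, hB, PowerSeries.coeff_map]
    push_cast
    rfl

/-! ### Asymptotics of the popularity -/

theorem popularity_isEquivalent :
    (fun n : ℕ => (popularity leftPath3 n : ℝ) / (n ! : ℝ)) ~[atTop]
      (fun n : ℕ => 8 * (Real.pi - 2) / Real.pi ^ 3 * (n : ℝ) ^ 2 * (2 / Real.pi) ^ n) := by
  set t : ℕ → ℝ := fun n => ((PowerSeries.coeff n (PowerSeries.cos ℚ * Eul) : ℚ) : ℝ) *
      (Real.pi / 2) ^ (n + 1) with ht
  have hpi := Real.pi_gt_three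
  have hpi0 : Real.pi ≠ 0 := Real.pi_ne_zero
  have hpi2 : Real.pi - 2 ≠ 0 := by linarith
  have hb : ∀ n, ((PowerSeries.coeff n (PowerSeries.cos ℚ * Eul) : ℚ) : ℝ) =
      t n * (2 / Real.pi) ^ (n + 1) := by
    intro n
    rw [ht]
    simp only
    rw [mul_assoc, ← mul_pow, div_mul_div_cancel₀ (by norm_num), div_self hpi0, one_pow, mul_one]
  have hpop : ∀ n, (popularity leftPath3 n : ℝ) / (n ! : ℝ) =
      (n + 1) * ((n + 1) * t (n + 1) * (2 / Real.pi) ^ (n + 2) -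
        (n + 2) * t (n + 2) * (2 / Real.pi) ^ (n + 3)) := by
    intro n
    have h := popularity_eq n
    rw [shiftedEuler_eq, shiftedEuler_eq, Nat.factorial_succ] at h
    have h' := congrArg (fun q : ℚ => (q : ℝ)) h
    push_cast at h'
    rw [hb, hb] at h'
    rw [h', div_eq_iff (by positivity)]
    ring
  have hne : ∀ᶠ n : ℕ in atTop,
      8 * (Real.pi - 2) / Real.pi ^ 3 * (n : ℝ) ^ 2 * (2 / Real.pi) ^ n ≠ 0 := by
    filter_upwards [eventually_gt_atTop 0] with n hn
    have : (n : ℝ) ≠ 0 := by exact_mod_cast hn.ne'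
    positivity
  rw [isEquivalent_iff_tendsto_one hne]
  have htend : Tendsto t atTop (nhds 2) := tendsto_coeff_cos_mul_Eul
  have ht1 := htend.comp (tendsto_add_atTop_nat 1)
  have ht2 := htend.comp (tendsto_add_atTop_nat 2)
  have hinv := tendsto_inv_atTop_nhds_zero_nat (𝕜 := ℝ)
  have h1 := hinv.const_add 1
  have h2 := (hinv.const_mul 2).const_add 1
  -- Both terms of `hpop` have order `n² (2/π)^n`. Their constants `2(2/π)²` and `2(2/π)³` differ,
  -- so the leading terms do not cancel and the limit of `t` suffices.
  have hlim := (h1.mul (((h1.mul ht1).mul_const ((2 / Real.pi) ^ 2)).sub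
    ((h2.mul ht2).mul_const ((2 / Real.pi) ^ 3)))).mul_const
      (8 * (Real.pi - 2) / Real.pi ^ 3)⁻¹
  have hval : (1 + 0) * ((1 + 0) * 2 * (2 / Real.pi) ^ 2 -
      (1 + 2 * 0) * 2 * (2 / Real.pi) ^ 3) * (8 * (Real.pi - 2) / Real.pi ^ 3)⁻¹ = 1 := by
    field_simp
    ring
  rw [hval] at hlim
  refine hlim.congr' ?_
  filter_upwards [eventually_gt_atTop 0] with n hn
  have hn0 : (n : ℝ) ≠ 0 := by exact_mod_cast hn.ne'
  simp only [Function.comp, Pi.div_apply]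
  rw [hpop, pow_add, pow_add]
  field_simp

end Treeshelf

theorem corollary6 :
    (Treeshelf.egf (fun n => (Treeshelf.popularity Treeshelf.leftPath3 n : ℚ)) =
      (1 - PowerSeries.sin ℚ + (PowerSeries.X - 1) * PowerSeries.cos ℚ) *
        ((1 - PowerSeries.sin ℚ) ^ 2)⁻¹) ∧
    (∀ n : ℕ, (Treeshelf.popularity Treeshelf.leftPath3 n : ℚ) =
      ((n : ℚ) + 1) * Treeshelf.shiftedEuler n - Treeshelf.shiftedEuler (n + 1)) ∧
    ((fun n : ℕ => (Treeshelf.popularity Treeshelf.leftPath3 n : ℝ) / (n ! : ℝ)) ~[atTop]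
      (fun n : ℕ => 8 * (Real.pi - 2) / Real.pi ^ 3 * (n : ℝ) ^ 2 * (2 / Real.pi) ^ n)) :=
  ⟨Treeshelf.egf_popularity_eq, Treeshelf.popularity_eq, Treeshelf.popularity_isEquivalent⟩
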